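/- **Proposition (Geometric Optics Limit).** Let $d\ge 0$, write points of phase space $\mathbb R^{d}\times\mathbb R^{d}$ as $\xi=(r,p)$, and let $H:\mathbb R^{2d}\to\mathbb R$ be smooth with all derivatives polynomially bounded (in particular, $H(r,p)=-n(r)+\frac{|p|^2}{2n(r)}$ is allowed whenever the refractive index $n$ is smooth with polynomially bounded derivatives and $n\ge c$ for some constant $c>0$). Let $\lambda>0$ be the wavelength and $\hbar=\lambda/2\pi$. Put $\Lambda=\overleftarrow{\partial_r}\cdot\overrightarrow{\partial_p}-\overleftarrow{\partial_p}\cdot\overrightarrow{\partial_r}$, so that $\{A,B\}=A\Lambda B=\partial_rA\cdot\partial_pB-\partial_pA\cdot\partial_rB$. The Moyal bracket $\{\{H,W\}\}_\lambda=\frac{2}{\hbar}\,H\sin\!\big(\tfrac{\hbar}{2}\Lambda\big)W$ of $H$ with a complex-valued Schwartz function $W$ is defined through the action of the sine on plane waves, i.e. with $\widehat W(\eta)=\int W(\xi)e^{-2\pi i\langle\xi,\eta\rangle}d\xi$ and $J(a,b)=(b,-a)$, $$\{\{H,W\}\}_\lambda(\xi)=\int_{\mathbb R^{2d}}\frac{i}{\hbar}\Big[H\big(\xi+\tfrac{\lambda}{2}J\eta\big)-H\big(\xi-\tfrac{\lambda}{2}J\eta\big)\Big]\widehat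 W(\eta)\,e^{2\pi i\langle\eta,\xi\rangle}\,d\eta ,$$ and the terms of its formal expansion are $T_n^\lambda(\xi)=\frac{(-1)^n}{(2n+1)!}\big(\frac{\hbar}{2}\big)^{2n}\big(H\Lambda^{2n+1}W\big)(\xi)$. The Wigner–Moyal equation is $\partial_zW=\{\{H,W\}\}_\lambda$; on an open $z$-interval $I$, a solution is a continuous map $z\mapsto W(z)$ from $I$ into the Schwartz space that is differentiable in $z$ at each fixed $\xi$ and satisfies the equation pointwise. A ray is a curve $\gamma=(r,p)$, defined on an open $z$-interval, with $\dot r=\partial_pH$, $\dot p=-\partial_rH$. Then: 1. (The wavelength-dependent terms vanish.) For every Schwartz function $W$: $T^\lambda_0=\{H,W\}$; for each $n\ge1$ and $\xi$, $T^\lambda_n(\xi)\to0$ as $\lambda\to0^+$; for all $N\ge0$, $\lambda_0>0$ and compact $K$ there is $C$ such that $\big|\{\{H,W\}\}_\lambda(\xi)-\sum_{n<N}T^\lambda_n(\xi)\big|\le C\lambda^{2N}$ for $0<\lambda\le\lambda_0$, $\xi\in K$; and $\{\{H,W\}\}_\lambda(\xi)\to\{H,W\}(\xi)$ as $\lambda\to0^+$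 for every $\xi$. 2. (The equation reduces to the Liouville equation.) Let $I$ be an open bounded interval, and suppose that for all sufficiently small $\lambda>0$ the family $W^\lambda$ solves the Wigner–Moyal equation at wavelength $\lambda$ for $z\in I$, and that $W^\lambda(z)\to W(z)$ in the Schwartz space as $\lambda\to0^+$, locally uniformly in $z\in I$. Then $\partial_zW^\lambda\to\partial_zW$ pointwise on $I\times\mathbb R^{2d}$, $W$ satisfies the Liouville equation $$\frac{\partial W}{\partial z}+\{W,H\}=0\qquad(z\in I),$$ and $W$ is transported along the rays: $z\mapsto W(z,\gamma(z))$ is constant for every ray $\gamma$ on a subinterval of $I$. 3. (Transport along the Hamiltonian ray flow.) For any $W:\mathbb R\times\mathbb R^{2d}\to\mathbb C$ that is (jointly) differentiable at each point of $I\times\mathbb R^{2d}$, $W$ satisfies the Liouville equation for $z\in I$ if and only if $z\mapsto W(z,\gamma(z))$ is constant along every ray $\gamma$ on a subinterval of $I$. The flow is incompressible: the Hamiltonian vector field $(\partial_pH,-\partial_rH)$ is divergence-free. -/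

import Mathlib

open Filter Topology Set
open scoped SchwartzMap FourierTransform

namespace WignerMoyal

noncomputable section

/-- Phase space `ℝ^d × ℝ^d`: the coordinate `Sum.inl i` is the position `r_i`, the coordinate
`Sum.inr i` is the momentum `p_i`. -/
abbrev Phase (d : ℕ) : Type := EuclideanSpace ℝ (Fin d ⊕ Fin d)

/-- The position component `r` of a phase space point. -/
def position {d : ℕ} (ξ : Phase d) : EuclideanSpace ℝ (Fin d) :=
  WithLp.toLp 2 fun i => ξ (Sum.inl i)

/-- The momentum component `p` of a phase space point. -/
def momentum {d : ℕ} (ξ : Phase d) : EuclideanSpace ℝ (Fin d) :=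
  WithLp.toLp 2 fun i => ξ (Sum.inr i)

/-- The partial derivative `∂F/∂r_i`. -/
def partialR {d : ℕ} {E : Type} [NormedAddCommGroup E] [NormedSpace ℝ E]
    (i : Fin d) (F : Phase d → E) (ξ : Phase d) : E :=
  fderiv ℝ F ξ (EuclideanSpace.single (Sum.inl i) (1 : ℝ))

/-- The partial derivative `∂F/∂p_i`. -/
def partialP {d : ℕ} {E : Type} [NormedAddCommGroup E] [NormedSpace ℝ E]
    (i : Fin d) (F : Phase d → E) (ξ : Phase d) : E :=
  fderiv ℝ F ξ (EuclideanSpace.single (Sum.inr i) (1 : ℝ))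

/-- The paraxial optical Hamiltonian `-n(r) + |p|² / (2 n(r))` of a medium with refractive
index `n`. -/
def opticalHamiltonian {d : ℕ} (n : EuclideanSpace ℝ (Fin d) → ℝ) (ξ : Phase d) : ℝ :=
  -n (position ξ) + ‖momentum ξ‖ ^ 2 / (2 * n (position ξ))

/-- A real function on phase space, regarded as a complex-valued one. -/
def toComplex {d : ℕ} (H : Phase d → ℝ) (ξ : Phase d) : ℂ := (H ξ : ℂ)

/-- The Poisson bracket `{A, B} = ∂A/∂r · ∂B/∂p - ∂A/∂p · ∂B/∂r`. -/
def poissonBracket {d : ℕ} (A B : Phase d → ℂ) (ξ : Phase d) : ℂ :=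
  ∑ i, (partialR i A ξ * partialP i B ξ - partialP i A ξ * partialR i B ξ)

/-- `A Λ^k B`, the `k`-th power of the bidifferential operator
`Λ = ←∂_r · →∂_p - ←∂_p · →∂_r` of the Poisson bracket, applied to `A` (on the left) and
`B` (on the right). -/
def poissonPower {d : ℕ} : ℕ → (Phase d → ℂ) → (Phase d → ℂ) → Phase d → ℂ
  | 0, A, B => fun ξ => A ξ * B ξ
  | k + 1, A, B => fun ξ => ∑ i, (poissonPower k (partialR i A) (partialP i B) ξ
      - poissonPower k (partialP i A) (partialR i B) ξ)

/-- The term of order `2 n` in the reduced wavelength `ħ = lam / 2π` of the Taylor expansion of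
`(2/ħ) A sin((ħ/2) Λ) B`, that is `(-1)^n / (2n+1)! * (ħ/2)^(2n) * A Λ^(2n+1) B`. -/
def moyalTerm {d : ℕ} (lam : ℝ) (n : ℕ) (A B : Phase d → ℂ) (ξ : Phase d) : ℂ :=
  (((-1) ^ n / (Nat.factorial (2 * n + 1) : ℝ) * (lam / (2 * Real.pi) / 2) ^ (2 * n) : ℝ) : ℂ)
    * poissonPower (2 * n + 1) A B ξ

/-- The symplectic matrix `J (a, b) = (b, -a)` acting on `ℝ^d × ℝ^d`. -/
def symplecticJ {d : ℕ} (η : Phase d) : Phase d :=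
  WithLp.toLp 2 (Sum.elim (fun i => η (Sum.inr i)) (fun i => -η (Sum.inl i)))

/-- The Moyal bracket `{{A, B}} = (2/ħ) A sin((ħ/2) Λ) B`, `ħ = lam / 2π`.
On a plane wave `B(ξ) = e(ξ) = exp(2πi⟨η, ξ⟩)` the operator `Λ` is `2πi` times the derivative of
`A` in the direction `J η`, so `exp(± i(ħ/2)Λ)` translates `A` by `∓ πħ J η = ∓ (lam/2) J η`, and
`(2/ħ) A sin((ħ/2) Λ) e = (i/ħ) (A(ξ + (lam/2) J η) - A(ξ - (lam/2) J η)) e(ξ)`.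
The bracket with a general `B` is the superposition of these over the Fourier decomposition
of `B`; `𝓕 B η = ∫ B(ξ) exp(-2πi⟨ξ, η⟩) dξ`. -/
def moyalBracket {d : ℕ} (lam : ℝ) (A B : Phase d → ℂ) (ξ : Phase d) : ℂ :=
  ∫ η : Phase d, Complex.I / ((lam / (2 * Real.pi) : ℝ) : ℂ)
    * (A (ξ + (lam / 2) • symplecticJ η) - A (ξ - (lam / 2) • symplecticJ η))
    * 𝓕 B η * Complex.exp (2 * Real.pi * Complex.I * (inner ℝ η ξ : ℝ))

/-- `W` is a (classical, Schwartz-class) solution for `z ∈ I` of the Wigner–Moyal equation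
`∂W/∂z = {{H, W}}` at wavelength `lam`. -/
structure SolvesWignerMoyal {d : ℕ} (H : Phase d → ℝ) (lam : ℝ) (I : Set ℝ)
    (W : ℝ → 𝓢(Phase d, ℂ)) : Prop where
  continuousOn : ContinuousOn W I
  differentiableAt : ∀ z ∈ I, ∀ ξ, DifferentiableAt ℝ (fun s => W s ξ) z
  equation : ∀ z ∈ I, ∀ ξ,
    deriv (fun s => W s ξ) z = moyalBracket lam (toComplex H) (W z) ξ

/-- `W` satisfies the Liouville equation `∂W/∂z + {W, H} = 0` for `z ∈ I`. -/
structure SolvesLiouville {d : ℕ} (H : Phase d → ℝ) (I : Set ℝ)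
    (W : ℝ → Phase d → ℂ) : Prop where
  differentiableAt : ∀ z ∈ I, ∀ ξ, DifferentiableAt ℝ (fun s => W s ξ) z
  equation : ∀ z ∈ I, ∀ ξ,
    deriv (fun s => W s ξ) z + poissonBracket (W z) (toComplex H) ξ = 0

/-- The Hamiltonian vector field `X_H = (∂H/∂p, -∂H/∂r)`. -/
def hamiltonianField {d : ℕ} (H : Phase d → ℝ) (ξ : Phase d) : Phase d :=
  WithLp.toLp 2 (Sum.elim (fun i => partialP i H ξ) (fun i => -partialR i H ξ))

/-- The divergence of a vector field on phase space. -/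
def divergence {d : ℕ} (X : Phase d → Phase d) (ξ : Phase d) : ℝ :=
  ∑ j, fderiv ℝ (fun ζ => X ζ j) ξ (EuclideanSpace.single j (1 : ℝ))

/-- `γ` is a Hamiltonian ray on `(s, t)`: it solves `dr/dz = ∂H/∂p`, `dp/dz = -∂H/∂r` there. -/
def IsRay {d : ℕ} (H : Phase d → ℝ) (s t : ℝ) (γ : ℝ → Phase d) : Prop :=
  ∀ z ∈ Ioo s t, HasDerivAt γ (hamiltonianField H (γ z)) z

/-- `W` is transported by the Hamiltonian ray flow for `z ∈ I`: it is constant along every ray. -/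
def TransportedAlongRays {d : ℕ} (H : Phase d → ℝ) (I : Set ℝ)
    (W : ℝ → Phase d → ℂ) : Prop :=
  ∀ (s t : ℝ) (γ : ℝ → Phase d), Ioo s t ⊆ I → IsRay H s t γ →
    ∀ z₁ ∈ Ioo s t, ∀ z₂ ∈ Ioo s t, W z₁ (γ z₁) = W z₂ (γ z₂)

end

end WignerMoyal

namespace WignerMoyal

/-! On the Fourier side the Moyal bracket integrates a symmetric difference of `H` in the direction
`J η` against `𝓕 W`. Its Taylor expansion keeps only odd orders, and `(2πi)^k` times the `k`-th
derivative of `H` along `J η` is the symbol of `Λ^k` (`poissonPower_eq_integral`), so the Taylor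
terms integrate exactly to the `moyalTerm`s. The remainder is `λ^(2N+1)` times a polynomial weight
in `η`; dividing by `ħ` costs one power of `λ`, and the decay of `𝓕 W` makes the rest integrable
(`norm_moyalBracket_sub_sum_le`).

The constant in this bound is a continuous function of `W` on Schwartz space, so `W` may vary with
`λ`. Hence the `z`-derivatives of the solutions converge locally uniformly, and the limit satisfies
the Liouville equation (`hasDerivAt_limit`). Its partial derivatives are jointly continuous, so it
is jointly differentiable. Along a ray the chain rule turns the left side of the Liouville equation
into a total derivative; conversely Picard–Lindelöf sends a ray through every point. -/

/-! ### Temperate growth of the optical Hamiltonian -/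

/-- The reciprocal of a function of temperate growth that is bounded below by a positive constant
has temperate growth. -/
theorem hasTemperateGrowth_inv {E : Type*} [NormedAddCommGroup E] [NormedSpace ℝ E]
    {n : E → ℝ} (hn : n.HasTemperateGrowth) {c : ℝ} (hc : 0 < c) (h : ∀ r, c ≤ n r) :
    (fun r => (n r)⁻¹).HasTemperateGrowth := by
  have hpos : ∀ x ∈ Ioi (c / 2), 0 < x := fun x hx => (half_pos hc).trans hx
  have key := Function.HasTemperateGrowth.comp' (t := Ioi (c / 2)) (g := Inv.inv) (f := n)
    (by rintro _ ⟨r, rfl⟩; exact (half_lt_self hc).trans_le (h r))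
    isOpen_Ioi.uniqueDiffOn
    (fun x hx => (contDiffAt_inv ℝ (hpos x hx).ne').contDiffWithinAt) ?_ hn
  · exact key
  intro N
  -- On `Ioi (c / 2)` the `k`-th derivative of the reciprocal is at most `k! (c/2)^(-(k+1))`. Growth
  -- exponent `0` therefore suffices, and the sum dominates all orders up to `N` at once.
  refine ⟨0, ∑ k ∈ Finset.range (N + 1), (k.factorial : ℝ) * ((c / 2) ^ (k + 1))⁻¹,
    by positivity, fun k hk x hx => ?_⟩
  rw [norm_iteratedFDerivWithin_eq_norm_iteratedDerivWithin,
    iteratedDerivWithin_eq_iteratedDeriv isOpen_Ioi.uniqueDiffOn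
      (contDiffAt_inv ℝ (hpos x hx).ne') hx, iteratedDeriv_eq_iterate, iter_deriv_inv,
    pow_zero, mul_one]
  have hx' : c / 2 ≤ x := le_of_lt hx
  have hx0 := hpos x hx
  have hterm : ‖(-1) ^ k * (k.factorial : ℝ) * x ^ (-1 - k : ℤ)‖
      ≤ (k.factorial : ℝ) * ((c / 2) ^ (k + 1))⁻¹ := by
    have : x ^ (-1 - k : ℤ) = (x ^ (k + 1))⁻¹ := by
      rw [← zpow_natCast, ← zpow_neg]; congr 1; push_cast; ring
    rw [this, norm_mul, norm_mul, norm_pow, norm_neg, norm_one, one_pow, one_mul,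
      Real.norm_of_nonneg (by positivity), Real.norm_of_nonneg (by positivity)]
    gcongr
  refine hterm.trans (Finset.single_le_sum
    (f := fun k : ℕ => (k.factorial : ℝ) * ((c / 2) ^ (k + 1))⁻¹)
    (fun _ _ => by positivity) (Finset.mem_range.2 (by omega)))

theorem hasTemperateGrowth_position {d : ℕ} :
    (position : Phase d → EuclideanSpace ℝ (Fin d)).HasTemperateGrowth :=
  (LinearMap.toContinuousLinearMap
    ({ toFun := position, map_add' := fun _ _ => rfl, map_smul' := fun _ _ => rfl } :
      Phase d →ₗ[ℝ] EuclideanSpace ℝ (Fin d))).hasTemperateGrowth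

theorem hasTemperateGrowth_momentum {d : ℕ} :
    (momentum : Phase d → EuclideanSpace ℝ (Fin d)).HasTemperateGrowth :=
  (LinearMap.toContinuousLinearMap
    ({ toFun := momentum, map_add' := fun _ _ => rfl, map_smul' := fun _ _ => rfl } :
      Phase d →ₗ[ℝ] EuclideanSpace ℝ (Fin d))).hasTemperateGrowth

theorem hasTemperateGrowth_opticalHamiltonian {d : ℕ} {n : EuclideanSpace ℝ (Fin d) → ℝ}
    (hn : n.HasTemperateGrowth) {c : ℝ} (hc : 0 < c) (h : ∀ r, c ≤ n r) :
    (opticalHamiltonian n).HasTemperateGrowth := by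
  have hsq := (Function.hasTemperateGrowth_norm_sq (EuclideanSpace ℝ (Fin d))).comp
    (hasTemperateGrowth_momentum (d := d))
  have hinv := (hasTemperateGrowth_inv hn hc h).comp (hasTemperateGrowth_position (d := d))
  have heq : opticalHamiltonian n = fun ξ => -(n ∘ position) ξ
      + (1 / 2 : ℝ) * (((fun p => ‖p‖ ^ 2) ∘ momentum) ξ * ((fun r => (n r)⁻¹) ∘ position) ξ) := by
    funext ξ
    simp only [opticalHamiltonian, Function.comp]
    field_simp
  rw [heq]
  exact (hn.comp hasTemperateGrowth_position).neg.add
    ((Function.HasTemperateGrowth.const _).mul (hsq.mul hinv))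

/-! ### Coordinates -/

theorem eq_sum_single {ι : Type*} [Fintype ι] [DecidableEq ι] (v : EuclideanSpace ℝ ι) :
    v = ∑ j, v j • EuclideanSpace.single j (1 : ℝ) := by
  ext k
  simp [Finset.sum_apply, Pi.single_apply]

theorem map_phase_eq_sum {d : ℕ} {E : Type} [NormedAddCommGroup E] [NormedSpace ℝ E]
    (L : Phase d →L[ℝ] E) (v : Phase d) :
    L v = ∑ i, (v (Sum.inl i) • L (EuclideanSpace.single (Sum.inl i) (1 : ℝ))
      + v (Sum.inr i) • L (EuclideanSpace.single (Sum.inr i) (1 : ℝ))) := by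
  conv_lhs => rw [eq_sum_single v]
  rw [Fintype.sum_sum_type, map_add, map_sum, map_sum, ← Finset.sum_add_distrib]
  simp only [map_smul]

theorem fderiv_toComplex {d : ℕ} {H : Phase d → ℝ} {ξ : Phase d} (hH : DifferentiableAt ℝ H ξ)
    (v : Phase d) : fderiv ℝ (toComplex H) ξ v = (fderiv ℝ H ξ v : ℂ) := by
  have := (Complex.ofRealCLM.hasFDerivAt (x := H ξ)).comp ξ hH.hasFDerivAt
  exact congrArg (fun L => L v) this.fderiv

/-- Links the bracket in the Liouville equation to differentiation along rays. -/
theorem fderiv_hamiltonianField {d : ℕ} {H : Phase d → ℝ} {ξ : Phase d}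
    (hH : DifferentiableAt ℝ H ξ) (F : Phase d → ℂ) :
    fderiv ℝ F ξ (hamiltonianField H ξ) = poissonBracket F (toComplex H) ξ := by
  rw [map_phase_eq_sum, poissonBracket]
  refine Finset.sum_congr rfl fun i _ => ?_
  have hR : partialR i (toComplex H) ξ = ((partialR i H ξ : ℝ) : ℂ) := fderiv_toComplex hH _
  have hP : partialP i (toComplex H) ξ = ((partialP i H ξ : ℝ) : ℂ) := fderiv_toComplex hH _
  rw [hR, hP]
  simp only [hamiltonianField, partialR, partialP, Sum.elim_inl, Sum.elim_inr, Complex.real_smul, Complex.ofReal_neg]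
  ring

theorem poissonBracket_comm {d : ℕ} (A B : Phase d → ℂ) (ξ : Phase d) :
    poissonBracket A B ξ = -poissonBracket B A ξ := by
  simp only [poissonBracket, ← Finset.sum_neg_distrib]
  exact Finset.sum_congr rfl fun i _ => by ring

/-! ### The Hamiltonian flow -/

theorem contDiff_hamiltonianField {d : ℕ} {H : Phase d → ℝ} (hH : ContDiff ℝ 2 H) :
    ContDiff ℝ 1 (hamiltonianField H) := by
  have h1 : ContDiff ℝ 1 (fderiv ℝ H) := hH.fderiv_right (by norm_num)
  rw [contDiff_euclidean]
  rintro (i | i)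
  · exact h1.clm_apply contDiff_const
  · exact (h1.clm_apply contDiff_const).neg

/-- The mixed second derivatives of `H` cancel in pairs by symmetry. -/
theorem divergence_hamiltonianField {d : ℕ} {H : Phase d → ℝ} (hH : ContDiff ℝ 2 H)
    (ξ : Phase d) : divergence (hamiltonianField H) ξ = 0 := by
  have h1 : DifferentiableAt ℝ (fderiv ℝ H) ξ :=
    ((hH.fderiv_right (m := 1) (by norm_num)).differentiable (by norm_num)).differentiableAt
  have hsymm : IsSymmSndFDerivAt ℝ H ξ := hH.contDiffAt.isSymmSndFDerivAt (by simp)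
  have hd : ∀ u v : Phase d, fderiv ℝ (fun ζ => fderiv ℝ H ζ u) ξ v
      = fderiv ℝ (fderiv ℝ H) ξ v u := fun u v => by
    rw [fderiv_clm_apply h1 (differentiableAt_const _)]
    simp
  simp only [divergence, Fintype.sum_sum_type, hamiltonianField, Sum.elim_inl, Sum.elim_inr,
    partialR, partialP, fderiv_fun_neg, neg_apply, hd]
  rw [← Finset.sum_add_distrib]
  exact Finset.sum_eq_zero fun i _ => by rw [hsymm.eq]; ring

/-- Splits the total derivative as `L (1, v) = L (1, 0) + L (0, v)`. Joint differentiability at the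
single point is enough. -/
theorem hasDerivAt_along {d : ℕ} {W : ℝ → Phase d → ℂ} {γ : ℝ → Phase d} {v : Phase d} {z : ℝ}
    (hW : DifferentiableAt ℝ (Function.uncurry W) (z, γ z)) (hγ : HasDerivAt γ v z) :
    HasDerivAt (fun s => W s (γ s))
      (deriv (fun s => W s (γ z)) z + fderiv ℝ (W z) (γ z) v) z := by
  obtain ⟨L, hL⟩ := hW
  have hz : HasDerivAt (fun s => W s (γ z)) (L (1, 0)) z :=
    hL.comp_hasDerivAt (f := fun s => (s, γ z)) z
      ((hasDerivAt_id z).prodMk (hasDerivAt_const z (γ z)))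
  have hξ : HasFDerivAt (W z) (L.comp (ContinuousLinearMap.inr ℝ ℝ (Phase d))) (γ z) :=
    hL.comp (f := fun ζ => (z, ζ)) (γ z) (hasFDerivAt_prodMk_right z (γ z))
  have := hL.comp_hasDerivAt (f := fun s => (s, γ s)) z ((hasDerivAt_id z).prodMk hγ)
  rw [hz.deriv, hξ.fderiv]
  convert! this using 1
  simp [← map_add]

theorem SolvesLiouville.transportedAlongRays {d : ℕ} {H : Phase d → ℝ}
    (hH : Differentiable ℝ H) {I : Set ℝ} {W : ℝ → Phase d → ℂ}
    (hW : ∀ z ∈ I, ∀ ξ, DifferentiableAt ℝ (Function.uncurry W) (z, ξ))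
    (h : SolvesLiouville H I W) : TransportedAlongRays H I W := by
  intro s t γ hst hγ z₁ hz₁ z₂ hz₂
  have hder : ∀ z ∈ Ioo s t, HasDerivAt (fun s => W s (γ s)) 0 z := fun z hz => by
    have := hasDerivAt_along (hW z (hst hz) (γ z)) (hγ z hz)
    rwa [fderiv_hamiltonianField (hH _), h.equation z (hst hz)] at this
  exact isOpen_Ioo.is_const_of_deriv_eq_zero isPreconnected_Ioo
    (f := fun s => W s (γ s))
    (fun z hz => (hder z hz).differentiableAt.differentiableWithinAt)
    (fun z hz => (hder z hz).deriv) hz₁ hz₂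

theorem TransportedAlongRays.solvesLiouville {d : ℕ} {H : Phase d → ℝ}
    (hH : ContDiff ℝ 2 H) {I : Set ℝ} (hI : IsOpen I) {W : ℝ → Phase d → ℂ}
    (hW : ∀ z ∈ I, ∀ ξ, DifferentiableAt ℝ (Function.uncurry W) (z, ξ))
    (h : TransportedAlongRays H I W) : SolvesLiouville H I W where
  differentiableAt z hz ξ :=
    (hW z hz ξ).comp (f := fun s => (s, ξ)) z (by fun_prop)
  equation z hz ξ := by
    obtain ⟨γ, hγz, ε, hε, hγ⟩ := (contDiff_hamiltonianField hH).contDiffAt (x := ξ)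
      |>.exists_forall_mem_closedBall_exists_eq_forall_mem_Ioo_hasDerivAt₀ z
    obtain ⟨δ, hδ, hδI⟩ := Metric.isOpen_iff.1 hI z hz
    rw [Real.ball_eq_Ioo] at hδI
    -- On this radius the ray exists and `z` stays inside `I`.
    set ρ := min ε δ with hρ
    have hρ0 : 0 < ρ := lt_min hε hδ
    have hsub : ∀ r, ρ ≤ r → Ioo (z - ρ) (z + ρ) ⊆ Ioo (z - r) (z + r) := fun r hr =>
      Ioo_subset_Ioo (by linarith) (by linarith)
    have hzmem : z ∈ Ioo (z - ρ) (z + ρ) := ⟨by linarith, by linarith⟩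
    have hray : IsRay H (z - ρ) (z + ρ) γ := fun s hs => hγ s (hsub ε (min_le_left _ _) hs)
    have hconst := h _ _ γ ((hsub δ (min_le_right _ _)).trans hδI) hray
    have hder := hasDerivAt_along (hW z hz (γ z)) (hray z hzmem)
    have hder' : HasDerivAt (fun s => W s (γ s)) 0 z :=
      (hasDerivAt_const z (W z (γ z))).congr_of_eventuallyEq <| by
        filter_upwards [Ioo_mem_nhds hzmem.1 hzmem.2] with s hs using hconst s hs z hzmem
    have := hder.unique hder'
    rwa [fderiv_hamiltonianField ((hH.differentiable (by norm_num)) _), hγz] at this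

/-! ### Taylor expansion of functions of temperate growth -/

theorem hasTemperateGrowth_toComplex {d : ℕ} {H : Phase d → ℝ} (hH : H.HasTemperateGrowth) :
    (toComplex H).HasTemperateGrowth :=
  Function.Complex.hasTemperateGrowth_ofReal.comp hH

/-- Integral form of the remainder, with `(1 - t)^n` and `1/n!` bounded by 1. The weight is
polynomial in `w` too, so it remains integrable against a Schwartz function once `w` is proportional
to `J η`. -/
theorem norm_taylor_remainder_le {E : Type*} [NormedAddCommGroup E] [NormedSpace ℝ E]
    {A : E → ℂ} (hA : A.HasTemperateGrowth) (n : ℕ) :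
    ∃ (k : ℕ) (C : ℝ), 0 ≤ C ∧ ∀ ξ w : E,
      ‖A (ξ + w) - ∑ j ∈ Finset.range (n + 1),
          (j.factorial : ℝ)⁻¹ • iteratedFDeriv ℝ j A ξ (fun _ => w)‖
        ≤ C * (1 + ‖ξ‖ + ‖w‖) ^ k * ‖w‖ ^ (n + 1) := by
  obtain ⟨k, C, hC, hb⟩ := hA.norm_iteratedFDeriv_le_uniform (n + 1)
  refine ⟨k, C, hC, fun ξ w => ?_⟩
  rw [map_add_eq_sum_add_integral_iteratedFDeriv (n := n)
    (fun t _ => (hA.1.of_le (by exact_mod_cast le_top)).contDiffAt), add_sub_cancel_left, norm_smul]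
  have hint : ‖∫ t in (0 : ℝ)..1, (1 - t) ^ n • iteratedFDeriv ℝ (n + 1) A (ξ + t • w)
      (fun _ => w)‖ ≤ C * (1 + ‖ξ‖ + ‖w‖) ^ k * ‖w‖ ^ (n + 1) * |1 - 0| := by
    refine intervalIntegral.norm_integral_le_of_norm_le_const fun t ht => ?_
    rw [uIoc_of_le zero_le_one] at ht
    have h1 : ‖(1 - t) ^ n‖ ≤ 1 := by
      rw [norm_pow, Real.norm_of_nonneg (by linarith [ht.2])]
      exact pow_le_one₀ (by linarith [ht.2]) (by linarith [ht.1])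
    have h2 : ‖ξ + t • w‖ ≤ ‖ξ‖ + ‖w‖ := by
      refine (norm_add_le _ _).trans ?_
      rw [norm_smul, Real.norm_of_nonneg ht.1.le]
      gcongr
      exact mul_le_of_le_one_left (norm_nonneg _) ht.2
    have h3 : ‖iteratedFDeriv ℝ (n + 1) A (ξ + t • w) (fun _ => w)‖
        ≤ C * (1 + ‖ξ‖ + ‖w‖) ^ k * ‖w‖ ^ (n + 1) := by
      refine (ContinuousMultilinearMap.le_opNorm _ _).trans ?_
      rw [Finset.prod_const, Finset.card_univ, Fintype.card_fin]
      gcongr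
      exact (hb _ le_rfl _).trans
        (mul_le_mul_of_nonneg_left (pow_le_pow_left₀ (by positivity) (by linarith) k) hC)
    rw [norm_smul]
    exact (mul_le_of_le_one_left (norm_nonneg _) h1).trans h3
  rw [sub_zero, abs_one, mul_one] at hint
  refine (mul_le_of_le_one_left (norm_nonneg _) ?_).trans hint
  rw [norm_inv, Real.norm_natCast]
  exact inv_le_one_of_one_le₀ (by exact_mod_cast n.factorial_pos)

theorem iteratedFDeriv_const_smul_apply {E : Type*} [NormedAddCommGroup E] [NormedSpace ℝ E]
    (A : E → ℂ) (j : ℕ) (ξ w : E) (t : ℝ) :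
    iteratedFDeriv ℝ j A ξ (fun _ => t • w) = (t : ℂ) ^ j * iteratedFDeriv ℝ j A ξ (fun _ => w) := by
  rw [ContinuousMultilinearMap.map_smul_univ _ (fun _ => t) (fun _ => w)]
  simp

theorem sum_range_sub_neg {E : Type*} [NormedAddCommGroup E] [NormedSpace ℝ E]
    (A : E → ℂ) (ξ w : E) (N : ℕ) :
    ∑ j ∈ Finset.range (2 * N + 1), (j.factorial : ℝ)⁻¹ • iteratedFDeriv ℝ j A ξ (fun _ => w)
      - ∑ j ∈ Finset.range (2 * N + 1),
          (j.factorial : ℝ)⁻¹ • iteratedFDeriv ℝ j A ξ (fun _ => -w)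
      = ∑ n ∈ Finset.range N, 2 * (((2 * n + 1).factorial : ℝ)⁻¹ : ℝ)
          * iteratedFDeriv ℝ (2 * n + 1) A ξ (fun _ => w) := by
  have hneg : ∀ j, iteratedFDeriv ℝ j A ξ (fun _ => -w)
      = (-1 : ℂ) ^ j * iteratedFDeriv ℝ j A ξ (fun _ => w) := fun j => by
    simpa using iteratedFDeriv_const_smul_apply A j ξ w (-1)
  simp only [hneg, Complex.real_smul]
  induction N with
  | zero => simp
  | succ N ih =>
    rw [show 2 * (N + 1) + 1 = 2 * N + 1 + 1 + 1 by ring, Finset.sum_range_succ _ N, ← ih]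
    simp only [Finset.sum_range_succ _ (2 * N + 1 + 1), Finset.sum_range_succ _ (2 * N + 1)]
    have h1 : (-1 : ℂ) ^ (2 * N + 1) = -1 := Odd.neg_one_pow ⟨N, rfl⟩
    have h2 : (-1 : ℂ) ^ (2 * N + 1 + 1) = 1 := Even.neg_one_pow ⟨N + 1, by ring⟩
    rw [h1, h2]
    ring

/-- Expanding to the even order `2 * N` leaves a remainder of order `2 * N + 1`, whose extra power
later absorbs the factor `1/ħ`. -/
theorem norm_sub_odd_taylor_le {E : Type*} [NormedAddCommGroup E] [NormedSpace ℝ E]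
    {A : E → ℂ} (hA : A.HasTemperateGrowth) (N : ℕ) :
    ∃ (k : ℕ) (C : ℝ), 0 ≤ C ∧ ∀ ξ w : E,
      ‖A (ξ + w) - A (ξ - w) - ∑ n ∈ Finset.range N, 2 * (((2 * n + 1).factorial : ℝ)⁻¹ : ℝ)
          * iteratedFDeriv ℝ (2 * n + 1) A ξ (fun _ => w)‖
        ≤ C * (1 + ‖ξ‖ + ‖w‖) ^ k * ‖w‖ ^ (2 * N + 1) := by
  obtain ⟨k, C, hC, hb⟩ := norm_taylor_remainder_le hA (2 * N)
  refine ⟨k, 2 * C, by positivity, fun ξ w => ?_⟩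
  have h1 := hb ξ w
  have h2 := hb ξ (-w)
  rw [norm_neg, ← sub_eq_add_neg] at h2
  rw [← sum_range_sub_neg]
  refine le_trans (le_of_eq ?_) ((norm_sub_le _ _).trans ((add_le_add h1 h2).trans (le_of_eq ?_)))
  · congr 1; abel
  · ring

/-! ### The Poisson powers on the Fourier side -/

theorem norm_symplecticJ {d : ℕ} (η : Phase d) : ‖symplecticJ η‖ = ‖η‖ := by
  simp [EuclideanSpace.norm_eq, symplecticJ, Fintype.sum_sum_type, add_comm]

theorem continuous_symplecticJ {d : ℕ} : Continuous (symplecticJ : Phase d → Phase d) :=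
  (LinearMap.toContinuousLinearMap
    ({ toFun := symplecticJ
       map_add' := fun x y => by
        ext (j | j) <;> simp [symplecticJ, add_comm]
       map_smul' := fun c x => by
        ext (j | j) <;> simp [symplecticJ] } : Phase d →ₗ[ℝ] Phase d)).continuous

theorem hasTemperateGrowth_fderiv_apply {E : Type*} [NormedAddCommGroup E] [NormedSpace ℝ E]
    {A : E → ℂ} (hA : A.HasTemperateGrowth) (u : E) :
    (fun ζ => fderiv ℝ A ζ u).HasTemperateGrowth := by
  have h1 : (fderiv ℝ A).HasTemperateGrowth := by
    refine ⟨hA.1.fderiv_right (by simp), fun n => ?_⟩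
    simpa only [norm_iteratedFDeriv_fderiv] using hA.2 (n + 1)
  exact (ContinuousLinearMap.apply ℝ ℂ u).hasTemperateGrowth.comp h1

theorem iteratedFDeriv_fderiv_apply {E : Type*} [NormedAddCommGroup E] [NormedSpace ℝ E]
    {A : E → ℂ} (hA : A.HasTemperateGrowth) (k : ℕ) (ξ u : E) (m : Fin k → E) :
    iteratedFDeriv ℝ k (fun ζ => fderiv ℝ A ζ u) ξ m = iteratedFDeriv ℝ k (fderiv ℝ A) ξ m u := by
  have h1 : ContDiff ℝ k (fderiv ℝ A) := (hA.1.of_le (by exact_mod_cast le_top)).fderiv_right le_rfl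
  exact congrArg (fun L => L m)
    ((ContinuousLinearMap.apply ℝ ℂ u).iteratedFDeriv_comp_left h1.contDiffAt le_rfl)

/-- Peels off the innermost derivative and expands it in coordinates, which reproduces the recursion
of `poissonPower`. -/
theorem iteratedFDeriv_succ_symplecticJ {d : ℕ} {A : Phase d → ℂ} (hA : A.HasTemperateGrowth)
    (k : ℕ) (ξ η : Phase d) :
    iteratedFDeriv ℝ (k + 1) A ξ (fun _ => symplecticJ η)
      = ∑ i, ((η (Sum.inr i) : ℂ) * iteratedFDeriv ℝ k (partialR i A) ξ (fun _ => symplecticJ η)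
        - (η (Sum.inl i) : ℂ) * iteratedFDeriv ℝ k (partialP i A) ξ (fun _ => symplecticJ η)) := by
  rw [iteratedFDeriv_succ_apply_right, map_phase_eq_sum]
  refine Finset.sum_congr rfl fun i _ => ?_
  unfold partialR partialP
  rw [iteratedFDeriv_fderiv_apply hA, iteratedFDeriv_fderiv_apply hA]
  simp only [symplecticJ, Sum.elim_inl, Sum.elim_inr, Complex.real_smul, Complex.ofReal_neg,
    neg_mul, ← sub_eq_add_neg]
  rfl

theorem continuous_planeWave {d : ℕ} (ξ : Phase d) : Continuous fun η : Phase d =>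
    Complex.exp (2 * Real.pi * Complex.I * (inner ℝ η ξ : ℝ)) := by
  fun_prop

theorem norm_planeWave {d : ℕ} (ξ η : Phase d) :
    ‖Complex.exp (2 * Real.pi * Complex.I * (inner ℝ η ξ : ℝ))‖ = 1 := by
  rw [show (2 * Real.pi * Complex.I * (inner ℝ η ξ : ℝ) : ℂ)
    = ((2 * Real.pi * inner ℝ η ξ : ℝ) : ℂ) * Complex.I by push_cast; ring]
  exact Complex.norm_exp_ofReal_mul_I _

theorem continuous_fourier {d : ℕ} (W : 𝓢(Phase d, ℂ)) : Continuous (𝓕 (W : Phase d → ℂ)) := by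
  rw [← SchwartzMap.fourier_coe]
  exact (𝓕 W).continuous

theorem continuous_iteratedFDeriv_symplecticJ {d : ℕ} (A : Phase d → ℂ) (k : ℕ) (ξ : Phase d) :
    Continuous fun η : Phase d => iteratedFDeriv ℝ k A ξ (fun _ => symplecticJ η) :=
  (iteratedFDeriv ℝ k A ξ).cont.comp (continuous_pi fun _ => continuous_symplecticJ)

theorem integrable_iteratedFDeriv_mul_fourier {d : ℕ} (A : Phase d → ℂ) (W : 𝓢(Phase d, ℂ))
    (k : ℕ) (ξ : Phase d) (c : ℂ) :
    MeasureTheory.Integrable fun η : Phase d =>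
      c * iteratedFDeriv ℝ k A ξ (fun _ => symplecticJ η) * 𝓕 (W : Phase d → ℂ) η
        * Complex.exp (2 * Real.pi * Complex.I * (inner ℝ η ξ : ℝ)) := by
  refine (((𝓕 W).integrable_pow_mul MeasureTheory.volume k).const_mul
    (‖c‖ * ‖iteratedFDeriv ℝ k A ξ‖)).mono' ?_ (.of_forall fun η => ?_)
  · exact (((continuous_const.mul (continuous_iteratedFDeriv_symplecticJ A k ξ)).mul
      (continuous_fourier W)).mul (continuous_planeWave ξ)).aestronglyMeasurable
  · rw [norm_mul, norm_planeWave, mul_one, norm_mul, norm_mul, SchwartzMap.fourier_coe]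
    have h := (iteratedFDeriv ℝ k A ξ).le_opNorm (fun _ => symplecticJ η)
    rw [Finset.prod_const, Finset.card_univ, Fintype.card_fin, norm_symplecticJ] at h
    calc _ ≤ ‖c‖ * (‖iteratedFDeriv ℝ k A ξ‖ * ‖η‖ ^ k) * ‖𝓕 (W : Phase d → ℂ) η‖ := by gcongr
      _ = _ := by ring

theorem partial_eq_lineDeriv {d : ℕ} (W : 𝓢(Phase d, ℂ)) (u : Phase d) :
    (fun ξ => fderiv ℝ W ξ u) = (LineDeriv.lineDerivOp u W : 𝓢(Phase d, ℂ)) := by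
  funext ξ
  exact (SchwartzMap.lineDerivOp_apply_eq_fderiv u W ξ).symm

theorem fourier_lineDeriv_apply {d : ℕ} (W : 𝓢(Phase d, ℂ)) (j : Fin d ⊕ Fin d) (η : Phase d) :
    𝓕 ((LineDeriv.lineDerivOp (EuclideanSpace.single j (1 : ℝ)) W : 𝓢(Phase d, ℂ)) : Phase d → ℂ) η
      = 2 * Real.pi * Complex.I * η j * 𝓕 (W : Phase d → ℂ) η := by
  rw [← SchwartzMap.fourier_coe, SchwartzMap.fourier_lineDerivOp_eq, ← SchwartzMap.fourier_coe]
  rw [smul_apply, SchwartzMap.smulLeftCLM_apply_apply (by fun_prop)]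
  simp [EuclideanSpace.inner_single_right, mul_assoc]

/-- Each derivative falling on `W` becomes multiplication by `2πi η_j`; these factors recombine with
the derivatives of `A` into a derivative along `J η`. The case `k = 0` is Fourier inversion. -/
theorem poissonPower_eq_integral {d : ℕ} (k : ℕ) {A : Phase d → ℂ} (hA : A.HasTemperateGrowth)
    (W : 𝓢(Phase d, ℂ)) (ξ : Phase d) :
    poissonPower k A W ξ = ∫ η : Phase d, (2 * Real.pi * Complex.I) ^ k
      * iteratedFDeriv ℝ k A ξ (fun _ => symplecticJ η) * 𝓕 (W : Phase d → ℂ) η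
        * Complex.exp (2 * Real.pi * Complex.I * (inner ℝ η ξ : ℝ)) := by
  -- Both arguments vary because each step of the recursion differentiates both.
  induction k generalizing A W with
  | zero =>
    have hinv : W ξ = ∫ η : Phase d,
        Complex.exp ((2 * Real.pi * inner ℝ η ξ : ℝ) * Complex.I) • 𝓕 (W : Phase d → ℂ) η := by
      rw [← Real.fourierInv_eq', ← SchwartzMap.fourier_coe, ← SchwartzMap.fourierInv_coe,
        FourierTransform.fourierInv_fourier_eq]
    simp only [poissonPower, pow_zero, one_mul, iteratedFDeriv_zero_apply]
    rw [hinv, ← MeasureTheory.integral_const_mul]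
    refine MeasureTheory.integral_congr_ae (.of_forall fun η => ?_)
    simp only [smul_eq_mul]
    rw [show (2 * Real.pi * Complex.I * (inner ℝ η ξ : ℝ) : ℂ)
      = ((2 * Real.pi * inner ℝ η ξ : ℝ) : ℂ) * Complex.I by push_cast; ring]
    ring
  | succ k ih =>
    have hR : ∀ i, partialR i (W : Phase d → ℂ)
        = (LineDeriv.lineDerivOp (EuclideanSpace.single (Sum.inl i) (1 : ℝ)) W : 𝓢(Phase d, ℂ)) :=
      fun i => partial_eq_lineDeriv W _
    have hP : ∀ i, partialP i (W : Phase d → ℂ)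
        = (LineDeriv.lineDerivOp (EuclideanSpace.single (Sum.inr i) (1 : ℝ)) W : 𝓢(Phase d, ℂ)) :=
      fun i => partial_eq_lineDeriv W _
    have hAR : ∀ i, (partialR i A).HasTemperateGrowth :=
      fun i => hasTemperateGrowth_fderiv_apply hA _
    have hAP : ∀ i, (partialP i A).HasTemperateGrowth :=
      fun i => hasTemperateGrowth_fderiv_apply hA _
    simp only [poissonPower, hR, hP, ih (hAR _), ih (hAP _)]
    have hint := fun (B : Phase d → ℂ) (V : 𝓢(Phase d, ℂ)) =>
      integrable_iteratedFDeriv_mul_fourier B V k ξ ((2 * Real.pi * Complex.I) ^ k)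
    simp only [← MeasureTheory.integral_sub (hint _ _) (hint _ _)]
    refine (MeasureTheory.integral_finsetSum _ fun i _ => (hint (partialR i A)
      (LineDeriv.lineDerivOp (EuclideanSpace.single (Sum.inr i) (1 : ℝ)) W)).sub
        (hint (partialP i A) (LineDeriv.lineDerivOp
          (EuclideanSpace.single (Sum.inl i) (1 : ℝ)) W))).symm.trans ?_
    refine MeasureTheory.integral_congr_ae (.of_forall fun η => ?_)
    simp only [Pi.sub_apply, fourier_lineDeriv_apply, iteratedFDeriv_succ_symplecticJ hA, Finset.mul_sum,
      Finset.sum_mul]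
    exact Finset.sum_congr rfl fun i _ => by ring

theorem poissonPower_one {d : ℕ} (A B : Phase d → ℂ) : poissonPower 1 A B = poissonBracket A B :=
  rfl

theorem moyalTerm_zero {d : ℕ} (lam : ℝ) (A B : Phase d → ℂ) (ξ : Phase d) :
    moyalTerm lam 0 A B ξ = poissonBracket A B ξ := by
  simp [moyalTerm, poissonPower_one]

theorem tendsto_moyalTerm {d n : ℕ} (hn : 1 ≤ n) (A B : Phase d → ℂ) (ξ : Phase d) :
    Tendsto (fun lam : ℝ => moyalTerm lam n A B ξ) (𝓝[>] 0) (𝓝 0) := by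
  have hc : Continuous fun lam : ℝ => moyalTerm lam n A B ξ := by
    unfold moyalTerm
    fun_prop
  have h := (hc.tendsto 0).mono_left (nhdsWithin_le_nhds (s := Ioi 0))
  have h0 : moyalTerm 0 n A B ξ = 0 := by
    simp [moyalTerm, zero_pow (show 2 * n ≠ 0 by omega)]
  rwa [h0] at h

theorem moyalTerm_eq_integral {d : ℕ} {lam : ℝ} (hlam : 0 < lam) (n : ℕ) {A : Phase d → ℂ}
    (hA : A.HasTemperateGrowth) (W : 𝓢(Phase d, ℂ)) (ξ : Phase d) :
    moyalTerm lam n A W ξ = ∫ η : Phase d, Complex.I / ((lam / (2 * Real.pi) : ℝ) : ℂ)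
      * (2 * (((2 * n + 1).factorial : ℝ)⁻¹ : ℝ)
        * iteratedFDeriv ℝ (2 * n + 1) A ξ (fun _ => (lam / 2) • symplecticJ η))
      * 𝓕 (W : Phase d → ℂ) η * Complex.exp (2 * Real.pi * Complex.I * (inner ℝ η ξ : ℝ)) := by
  rw [moyalTerm, poissonPower_eq_integral _ hA, ← MeasureTheory.integral_const_mul]
  refine MeasureTheory.integral_congr_ae (.of_forall fun η => ?_)
  simp only [iteratedFDeriv_const_smul_apply]
  have hl : (lam : ℂ) ≠ 0 := by exact_mod_cast hlam.ne'
  have hpi : (Real.pi : ℂ) ≠ 0 := by exact_mod_cast Real.pi_ne_zero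
  -- Since `(ħ/2) · 2π = λ/2` and `i^(2n+1) = (-1)^n i`, both sides equal `2πi (λ/2)^(2n) /
  -- (2n+1)!`.
  have key : ((((-1) ^ n / (Nat.factorial (2 * n + 1) : ℝ)
        * (lam / (2 * Real.pi) / 2) ^ (2 * n) : ℝ) : ℂ)) * (2 * Real.pi * Complex.I) ^ (2 * n + 1)
      = Complex.I / ((lam / (2 * Real.pi) : ℝ) : ℂ)
        * (2 * (((2 * n + 1).factorial : ℝ)⁻¹ : ℝ) * ((lam / 2 : ℝ) : ℂ) ^ (2 * n + 1)) := by
    have hI : Complex.I ^ (2 * n + 1) = (-1) ^ n * Complex.I := by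
      rw [pow_succ, pow_mul, Complex.I_sq]
    have h1 : ((-1 : ℂ) ^ n) * (-1) ^ n = 1 := by rw [← mul_pow]; simp
    have h2 : ((lam : ℂ) / (2 * Real.pi) / 2) ^ (2 * n) * (2 * Real.pi) ^ (2 * n)
        = ((lam : ℂ) / 2) ^ (2 * n) := by
      rw [← mul_pow]; congr 1; field_simp
    have h3 : Complex.I / ((lam : ℂ) / (2 * Real.pi)) * (2 * ((lam : ℂ) / 2))
        = 2 * Real.pi * Complex.I := by
      field_simp
    push_cast
    rw [mul_pow _ Complex.I, hI, pow_succ (2 * (Real.pi : ℂ)), pow_succ ((lam : ℂ) / 2), ← h2]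
    generalize ((lam : ℂ) / (2 * Real.pi) / 2) ^ (2 * n) = a at *
    generalize (2 * (Real.pi : ℂ)) ^ (2 * n) = b at *
    generalize (((2 * n + 1).factorial : ℕ) : ℂ) = f at *
    linear_combination (f⁻¹ * a * b * (2 * Real.pi * Complex.I)) * h1 - (f⁻¹ * a * b) * h3
  linear_combination (iteratedFDeriv ℝ (2 * n + 1) A ξ (fun _ => symplecticJ η)
    * 𝓕 (W : Phase d → ℂ) η * Complex.exp (2 * Real.pi * Complex.I * (inner ℝ η ξ : ℝ))) * key

/-! ### The remainder of the expansion of the Moyal bracket -/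

theorem integrable_weight_mul_fourier {d : ℕ} (M : ℕ) (W : 𝓢(Phase d, ℂ)) :
    MeasureTheory.Integrable fun η : Phase d =>
      2 ^ M * (‖𝓕 (W : Phase d → ℂ) η‖ + ‖η‖ ^ M * ‖𝓕 (W : Phase d → ℂ) η‖) := by
  have h0 := (𝓕 W).integrable_pow_mul MeasureTheory.volume 0
  simp only [pow_zero, one_mul] at h0
  exact (h0.add ((𝓕 W).integrable_pow_mul MeasureTheory.volume M)).const_mul _

theorem one_add_pow_mul_le {x y : ℝ} (hx : 0 ≤ x) (hy : 0 ≤ y) (M : ℕ) :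
    (1 + x) ^ M * y ≤ 2 ^ M * (y + x ^ M * y) := by
  have h : (1 + x) ^ M ≤ 2 ^ M * (1 + x ^ M) := by
    have := add_pow_le zero_le_one hx M
    rw [one_pow] at this
    refine this.trans ?_
    gcongr
    · norm_num
    · omega
  calc (1 + x) ^ M * y ≤ 2 ^ M * (1 + x ^ M) * y := by gcongr
    _ = _ := by ring

/-- The weighted integral is controlled by finitely many Schwartz seminorms of `𝓕 W`. Continuity of
the bound in `W` is what later allows `W` to depend on `λ`. -/
theorem exists_continuous_integral_weight_le {d : ℕ} (M : ℕ) :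
    ∃ q : 𝓢(Phase d, ℂ) → ℝ, Continuous q ∧ ∀ W : 𝓢(Phase d, ℂ),
      ∫ η : Phase d, 2 ^ M * (‖𝓕 (W : Phase d → ℂ) η‖ + ‖η‖ ^ M * ‖𝓕 (W : Phase d → ℂ) η‖)
        ≤ q W := by
  set m := (MeasureTheory.volume : MeasureTheory.Measure (Phase d)).integrablePower with hm
  set D : ℝ := 2 ^ m * ∫ x : Phase d, (1 + ‖x‖) ^ (-(m : ℝ)) with hD
  have hsem : ∀ k : ℕ, Continuous fun W : 𝓢(Phase d, ℂ) => SchwartzMap.seminorm ℝ k 0 (𝓕 W) :=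
    fun k => ((schwartz_withSeminorms ℝ (Phase d) ℂ).continuous_seminorm (k, 0)).comp
      (SchwartzMap.fourierTransformCLM ℂ).continuous
  have hle : ∀ (k : ℕ) (W : 𝓢(Phase d, ℂ)), ∫ η : Phase d, ‖η‖ ^ k * ‖𝓕 (W : Phase d → ℂ) η‖
      ≤ D * (SchwartzMap.seminorm ℝ 0 0 (𝓕 W) + SchwartzMap.seminorm ℝ (k + m) 0 (𝓕 W)) :=
    fun k W => by
      simpa only [norm_iteratedFDeriv_zero, SchwartzMap.fourier_coe] using
        SchwartzMap.integral_pow_mul_iteratedFDeriv_le ℝ MeasureTheory.volume (𝓕 W) k 0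
  refine ⟨fun W => 2 ^ M *
    (D * (SchwartzMap.seminorm ℝ 0 0 (𝓕 W) + SchwartzMap.seminorm ℝ (0 + m) 0 (𝓕 W))
      + D * (SchwartzMap.seminorm ℝ 0 0 (𝓕 W) + SchwartzMap.seminorm ℝ (M + m) 0 (𝓕 W))),
    ?_, fun W => ?_⟩
  · exact continuous_const.mul ((continuous_const.mul ((hsem 0).add (hsem _))).add
      (continuous_const.mul ((hsem 0).add (hsem _))))
  · have h0 := (𝓕 W).integrable_pow_mul MeasureTheory.volume 0
    have hM := (𝓕 W).integrable_pow_mul MeasureTheory.volume M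
    rw [SchwartzMap.fourier_coe] at h0 hM
    have hle0 := hle 0 W
    simp only [pow_zero, one_mul] at h0 hle0
    rw [MeasureTheory.integral_const_mul, MeasureTheory.integral_add h0 hM]
    exact mul_le_mul_of_nonneg_left (add_le_add hle0 (hle M W)) (by positivity)

theorem norm_remainder_integrand_le {d : ℕ} {A : Phase d → ℂ} (hA : A.HasTemperateGrowth)
    (N : ℕ) (R lam₀ : ℝ) (hR : 0 ≤ R) (hlam₀ : 0 < lam₀) :
    ∃ (M : ℕ) (C : ℝ), 0 ≤ C ∧ ∀ lam ∈ Ioc 0 lam₀, ∀ ξ : Phase d, ‖ξ‖ ≤ R →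
      ∀ (W : 𝓢(Phase d, ℂ)) (η : Phase d),
      ‖Complex.I / ((lam / (2 * Real.pi) : ℝ) : ℂ)
        * (A (ξ + (lam / 2) • symplecticJ η) - A (ξ - (lam / 2) • symplecticJ η)
          - ∑ n ∈ Finset.range N, 2 * (((2 * n + 1).factorial : ℝ)⁻¹ : ℝ)
            * iteratedFDeriv ℝ (2 * n + 1) A ξ (fun _ => (lam / 2) • symplecticJ η))
        * 𝓕 (W : Phase d → ℂ) η * Complex.exp (2 * Real.pi * Complex.I * (inner ℝ η ξ : ℝ))‖
      ≤ C * lam ^ (2 * N)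
        * (2 ^ M * (‖𝓕 (W : Phase d → ℂ) η‖ + ‖η‖ ^ M * ‖𝓕 (W : Phase d → ℂ) η‖)) := by
  obtain ⟨k, C, hC, hb⟩ := norm_sub_odd_taylor_le hA N
  -- The exponent `k` comes from the growth weight and `2 * N + 1` from `‖w‖ ^ (2 * N + 1)`. The
  -- factor `2π/λ` is `1/ħ`, and its `λ` cancels one power.
  refine ⟨k + (2 * N + 1), 2 * Real.pi * (C * (1 + R + lam₀) ^ k), by positivity,
    fun lam hlam ξ hξ W η => ?_⟩
  have hl := hlam.1
  have hw : ‖(lam / 2) • symplecticJ η‖ = lam / 2 * ‖η‖ := by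
    rw [norm_smul, norm_symplecticJ, Real.norm_of_nonneg (by positivity)]
  have hη := norm_nonneg η
  have h1 : 1 + ‖ξ‖ + lam / 2 * ‖η‖ ≤ (1 + R + lam₀) * (1 + ‖η‖) := by
    have : lam / 2 * ‖η‖ ≤ lam₀ * ‖η‖ := by gcongr; linarith [hlam.2]
    nlinarith [mul_nonneg hR hη]
  have h2 : lam / 2 * ‖η‖ ≤ lam * (1 + ‖η‖) := by nlinarith
  have h3 := hb ξ ((lam / 2) • symplecticJ η)
  rw [hw] at h3
  have h4 : C * (1 + ‖ξ‖ + lam / 2 * ‖η‖) ^ k * (lam / 2 * ‖η‖) ^ (2 * N + 1)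
      ≤ C * ((1 + R + lam₀) * (1 + ‖η‖)) ^ k * (lam * (1 + ‖η‖)) ^ (2 * N + 1) := by gcongr
  have h5 : ‖Complex.I / ((lam / (2 * Real.pi) : ℝ) : ℂ)‖ = 2 * Real.pi / lam := by
    rw [norm_div, Complex.norm_I, Complex.norm_real,
      Real.norm_of_nonneg (by positivity), one_div_div]
  rw [norm_mul, norm_planeWave, mul_one, norm_mul, norm_mul, h5]
  calc _ ≤ 2 * Real.pi / lam * (C * ((1 + R + lam₀) * (1 + ‖η‖)) ^ k
        * (lam * (1 + ‖η‖)) ^ (2 * N + 1)) * ‖𝓕 (W : Phase d → ℂ) η‖ := by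
        gcongr; exact h3.trans h4
    _ = 2 * Real.pi * (C * (1 + R + lam₀) ^ k) * lam ^ (2 * N)
        * ((1 + ‖η‖) ^ (k + (2 * N + 1)) * ‖𝓕 (W : Phase d → ℂ) η‖) := by
        rw [mul_pow, mul_pow, pow_succ lam, pow_add]; field_simp; ring
    _ ≤ _ := mul_le_mul_of_nonneg_left (one_add_pow_mul_le hη (norm_nonneg _) _) (by positivity)

theorem norm_moyalBracket_sub_sum_le {d : ℕ} {A : Phase d → ℂ} (hA : A.HasTemperateGrowth)
    (N : ℕ) (R lam₀ : ℝ) (hR : 0 ≤ R) (hlam₀ : 0 < lam₀) :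
    ∃ q : 𝓢(Phase d, ℂ) → ℝ, Continuous q ∧ ∀ lam ∈ Ioc 0 lam₀, ∀ ξ : Phase d, ‖ξ‖ ≤ R →
      ∀ W : 𝓢(Phase d, ℂ),
      ‖moyalBracket lam A W ξ - ∑ n ∈ Finset.range N, moyalTerm lam n A W ξ‖
        ≤ q W * lam ^ (2 * N) := by
  obtain ⟨M, C, hC, hb⟩ := norm_remainder_integrand_le hA N R lam₀ hR hlam₀
  obtain ⟨q, hq, hqb⟩ := exists_continuous_integral_weight_le (d := d) M
  refine ⟨fun W => C * q W, continuous_const.mul hq, fun lam hlam ξ hξ W => ?_⟩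
  have hl := hlam.1
  have hJ : Continuous fun η : Phase d => (lam / 2) • symplecticJ η := by
    have := continuous_symplecticJ (d := d)
    fun_prop
  have hterm : ∀ n, MeasureTheory.Integrable fun η : Phase d =>
      Complex.I / ((lam / (2 * Real.pi) : ℝ) : ℂ)
      * (2 * (((2 * n + 1).factorial : ℝ)⁻¹ : ℝ)
        * iteratedFDeriv ℝ (2 * n + 1) A ξ (fun _ => (lam / 2) • symplecticJ η))
      * 𝓕 (W : Phase d → ℂ) η * Complex.exp (2 * Real.pi * Complex.I * (inner ℝ η ξ : ℝ)) := by
    intro n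
    refine (integrable_iteratedFDeriv_mul_fourier A W (2 * n + 1) ξ
      (Complex.I / ((lam / (2 * Real.pi) : ℝ) : ℂ) * (2 * (((2 * n + 1).factorial : ℝ)⁻¹ : ℝ)
        * ((lam / 2 : ℝ) : ℂ) ^ (2 * n + 1)))).congr (.of_forall fun η => ?_)
    simp only [iteratedFDeriv_const_smul_apply]
    ring
  set rem : Phase d → ℂ := fun η => Complex.I / ((lam / (2 * Real.pi) : ℝ) : ℂ)
        * (A (ξ + (lam / 2) • symplecticJ η) - A (ξ - (lam / 2) • symplecticJ η)
          - ∑ n ∈ Finset.range N, 2 * (((2 * n + 1).factorial : ℝ)⁻¹ : ℝ)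
            * iteratedFDeriv ℝ (2 * n + 1) A ξ (fun _ => (lam / 2) • symplecticJ η))
        * 𝓕 (W : Phase d → ℂ) η * Complex.exp (2 * Real.pi * Complex.I * (inner ℝ η ξ : ℝ))
    with hrem
  have hmeas : Continuous rem := by
    have hAc := hA.1.continuous
    refine ((continuous_const.mul (((hAc.comp (continuous_const.add hJ)).sub
      (hAc.comp (continuous_const.sub hJ))).sub (continuous_finsetSum _ fun n _ =>
        continuous_const.mul ((iteratedFDeriv ℝ (2 * n + 1) A ξ).cont.comp
          (continuous_pi fun _ => hJ))))).mul (continuous_fourier W)).mul (continuous_planeWave ξ)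
  have hbound := (integrable_weight_mul_fourier M W).const_mul (C * lam ^ (2 * N))
  have hremint : MeasureTheory.Integrable rem :=
    hbound.mono' hmeas.aestronglyMeasurable (.of_forall fun η => hb lam hlam ξ hξ W η)
  have heq : moyalBracket lam A W ξ - ∑ n ∈ Finset.range N, moyalTerm lam n A W ξ
      = ∫ η, rem η := by
    rw [sub_eq_iff_eq_add, Finset.sum_congr rfl fun n _ => moyalTerm_eq_integral hl n hA W ξ,
      ← MeasureTheory.integral_finsetSum _ fun n _ => hterm n,
      ← MeasureTheory.integral_add hremint (MeasureTheory.integrable_finsetSum _ fun n _ => hterm n),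
      moyalBracket]
    refine MeasureTheory.integral_congr_ae (.of_forall fun η => ?_)
    simp only [hrem, ← Finset.sum_mul, ← Finset.mul_sum]
    ring
  rw [heq]
  refine (MeasureTheory.norm_integral_le_of_norm_le hbound
    (.of_forall fun η => hb lam hlam ξ hξ W η)).trans ?_
  rw [MeasureTheory.integral_const_mul]
  calc _ ≤ C * lam ^ (2 * N) * q W := by gcongr; exact hqb W
    _ = _ := by ring

/-! ### The geometric optics limit of the equation -/

/-- The derivative map is continuous from Schwartz space into bounded continuous functions, where
evaluation is jointly continuous. -/
theorem continuous_eval_fderiv {d : ℕ} :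
    Continuous fun p : 𝓢(Phase d, ℂ) × Phase d => fderiv ℝ p.1 p.2 := by
  have h := (SchwartzMap.toBoundedContinuousFunctionCLM ℝ (Phase d)
    (Phase d →L[ℝ] ℂ)).continuous.comp (SchwartzMap.fderivCLM ℝ (Phase d) ℂ).continuous
  exact (h.comp continuous_fst).eval continuous_snd

theorem poissonBracket_toComplex_eq {d : ℕ} {H : Phase d → ℝ} {ξ : Phase d}
    (hH : DifferentiableAt ℝ H ξ) (F : Phase d → ℂ) :
    poissonBracket (toComplex H) F ξ = -fderiv ℝ F ξ (hamiltonianField H ξ) := by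
  rw [fderiv_hamiltonianField hH, poissonBracket_comm]

theorem continuous_poissonBracket {d : ℕ} {H : Phase d → ℝ} (hH : ContDiff ℝ 2 H) :
    Continuous fun p : 𝓢(Phase d, ℂ) × Phase d => poissonBracket (toComplex H) p.1 p.2 := by
  simp only [poissonBracket_toComplex_eq (hH.differentiable (by norm_num)).differentiableAt]
  exact (continuous_eval_fderiv.clm_apply
    ((contDiff_hamiltonianField hH).continuous.comp continuous_snd)).neg

/-- With a continuous limit, locally uniform convergence amounts to convergence along product
filters. This lemma and the next pass between the two forms. -/
theorem tendsto_prod_of_tendstoLocallyUniformlyOn {α β ι : Type*} [TopologicalSpace α]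
    [UniformSpace β] {F : ι → α → β} {f : α → β} {l : Filter ι} {s : Set α} {x : α}
    (h : TendstoLocallyUniformlyOn F f l s) (hf : ContinuousOn f s) (hx : x ∈ s) :
    Tendsto (fun q : ι × α => F q.1 q.2) (l ×ˢ 𝓝[s] x) (𝓝 (f x)) :=
  Filter.Tendsto.congr_uniformity (Tendsto.comp (hf x hx) tendsto_snd)
    (tendstoUniformlyOnFilter_iff_tendsto.1 (tendstoLocallyUniformlyOn_iff_filter.1 h x hx))

theorem tendstoLocallyUniformlyOn_of_tendsto_prod {α β ι : Type*} [TopologicalSpace α]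
    [UniformSpace β] {F : ι → α → β} {f : α → β} {l : Filter ι} {s : Set α}
    (hf : ContinuousOn f s)
    (h : ∀ x ∈ s, Tendsto (fun q : ι × α => F q.1 q.2) (l ×ˢ 𝓝[s] x) (𝓝 (f x))) :
    TendstoLocallyUniformlyOn F f l s :=
  tendstoLocallyUniformlyOn_iff_filter.2 fun x hx =>
    tendstoUniformlyOnFilter_iff_tendsto.2 <|
      ((Tendsto.comp (hf x hx) tendsto_snd).prodMk_nhds (h x hx)).mono_right
        (nhds_le_uniformity _)

/-- The index filter is arbitrary so that it may carry `λ` alone or the pair `(λ, z)`. The case `N =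
1` of the expansion gives an error `O(λ²)`, locally bounded in the Schwartz function. -/
theorem tendsto_moyalBracket_prod {d : ℕ} {H : Phase d → ℝ} (hH : H.HasTemperateGrowth)
    {ι : Type*} {l : Filter ι} {lam : ι → ℝ} {V : ι → 𝓢(Phase d, ℂ)} {W : 𝓢(Phase d, ℂ)}
    (hlam : Tendsto lam l (𝓝[>] 0)) (hV : Tendsto V l (𝓝 W)) (ξ : Phase d) :
    Tendsto (fun i => moyalBracket (lam i) (toComplex H) (V i) ξ) l
      (𝓝 (poissonBracket (toComplex H) W ξ)) := by
  obtain ⟨q, hqc, hq⟩ := norm_moyalBracket_sub_sum_le (hasTemperateGrowth_toComplex hH) 1 ‖ξ‖ 1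
    (norm_nonneg _) one_pos
  have hP : Tendsto (fun i => poissonBracket (toComplex H) (V i) ξ) l
      (𝓝 (poissonBracket (toComplex H) W ξ)) :=
    ((continuous_poissonBracket (contDiff_infty.1 hH.1 2)).comp
      (Continuous.prodMk_left ξ)).continuousAt.tendsto.comp hV
  have hD : Tendsto (fun i => moyalBracket (lam i) (toComplex H) (V i) ξ
      - poissonBracket (toComplex H) (V i) ξ) l (𝓝 0) := by
    have h0 : Tendsto (fun i => q (V i) * lam i ^ (2 * 1)) l (𝓝 0) := by
      simpa using ((hqc.tendsto W).comp hV).mul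
        ((tendsto_nhds_of_tendsto_nhdsWithin hlam).pow (2 * 1))
    refine squeeze_zero_norm' ?_ h0
    filter_upwards [hlam (Ioc_mem_nhdsGT (zero_lt_one' ℝ))] with i hi
    simpa only [Finset.sum_range_one, moyalTerm_zero] using hq (lam i) hi ξ le_rfl (V i)
  simpa using hD.add hP

theorem tendsto_moyalBracket {d : ℕ} {H : Phase d → ℝ} (hH : H.HasTemperateGrowth)
    (W : 𝓢(Phase d, ℂ)) (ξ : Phase d) :
    Tendsto (fun lam : ℝ => moyalBracket lam (toComplex H) W ξ) (𝓝[>] 0)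
      (𝓝 (poissonBracket (toComplex H) W ξ)) :=
  tendsto_moyalBracket_prod hH tendsto_id tendsto_const_nhds ξ

/-- The equation turns convergence of the brackets into locally uniform convergence of the
`z`-derivatives, so limit and derivative can be exchanged. -/
theorem hasDerivAt_limit {d : ℕ} {H : Phase d → ℝ} (hH : H.HasTemperateGrowth) {I : Set ℝ}
    (hI : IsOpen I) {Wl : ℝ → ℝ → 𝓢(Phase d, ℂ)} {W : ℝ → 𝓢(Phase d, ℂ)}
    (hWl : ∀ᶠ lam in 𝓝[>] (0 : ℝ), SolvesWignerMoyal H lam I (Wl lam))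
    (hlim : TendstoLocallyUniformlyOn Wl W (𝓝[>] 0) I) (hW : ContinuousOn W I)
    {z : ℝ} (hz : z ∈ I) (ξ : Phase d) :
    HasDerivAt (fun s => W s ξ) (poissonBracket (toComplex H) (W z) ξ) z := by
  have hH2 : ContDiff ℝ 2 H := (contDiff_infty.1 hH.1 2)
  have hev : Continuous fun V : 𝓢(Phase d, ℂ) => V ξ :=
    ((BoundedContinuousFunction.evalCLM ℝ ξ).comp
      (SchwartzMap.toBoundedContinuousFunctionCLM ℝ (Phase d) ℂ)).continuous
  have hpc : ContinuousOn (fun z => poissonBracket (toComplex H) (W z) ξ) I :=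
    ((continuous_poissonBracket hH2).comp (Continuous.prodMk_left ξ)).comp_continuousOn hW
  refine hasDerivAt_of_tendstoLocallyUniformlyOn (f := fun lam s => Wl lam s ξ)
    (f' := fun lam s => moyalBracket lam (toComplex H) (Wl lam s) ξ)
    (g' := fun s => poissonBracket (toComplex H) (W s) ξ) hI
    (tendstoLocallyUniformlyOn_of_tendsto_prod hpc fun x hx =>
      tendsto_moyalBracket_prod hH tendsto_fst
        (tendsto_prod_of_tendstoLocallyUniformlyOn hlim hW hx) ξ) ?_
    (fun s hs => (hev.tendsto _).comp (hlim.tendsto_at hs)) hz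
  filter_upwards [hWl] with lam h s hs
  rw [← h.equation s hs ξ]
  exact (h.differentiableAt s hs ξ).hasDerivAt

/-- The equation makes the `z`-partial jointly continuous, the Schwartz topology the `ξ`-partial;
continuous partials give joint differentiability. -/
theorem differentiableAt_uncurry_of_hasDerivAt {d : ℕ} {H : Phase d → ℝ} (hH : ContDiff ℝ 2 H)
    {I : Set ℝ} (hI : IsOpen I) {W : ℝ → 𝓢(Phase d, ℂ)} (hW : ContinuousOn W I)
    (hder : ∀ z ∈ I, ∀ ξ,
      HasDerivAt (fun s => W s ξ) (poissonBracket (toComplex H) (W z) ξ) z)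
    {z : ℝ} (hz : z ∈ I) (ξ : Phase d) :
    DifferentiableAt ℝ (Function.uncurry fun z => (W z : Phase d → ℂ)) (z, ξ) := by
  have hnhds : ∀ᶠ v : ℝ × Phase d in 𝓝 (z, ξ), v.1 ∈ I :=
    continuous_fst.continuousAt.eventually (hI.mem_nhds hz)
  have hpair : ContinuousAt (fun v : ℝ × Phase d => (W v.1, v.2)) (z, ξ) :=
    ((hW.continuousAt (hI.mem_nhds hz)).comp (f := Prod.fst) (x := (z, ξ))
      continuousAt_fst).prodMk continuousAt_snd
  have hz' : ∀ᶠ v : ℝ × Phase d in 𝓝 (z, ξ), HasFDerivAt (fun s => W s v.2)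
      (ContinuousLinearMap.toSpanSingletonCLE (𝕜 := ℝ) (E := ℂ)
        (poissonBracket (toComplex H) (W v.1) v.2)) v.1 := by
    filter_upwards [hnhds] with v hv using (hder v.1 hv v.2).hasFDerivAt
  have hξ' : ∀ᶠ v : ℝ × Phase d in 𝓝 (z, ξ), HasFDerivAt (fun ζ => W v.1 ζ)
      (fderiv ℝ (W v.1) v.2) v.2 := .of_forall fun v => (W v.1).differentiableAt.hasFDerivAt
  have hzc : ContinuousAt (fun v : ℝ × Phase d =>
      ContinuousLinearMap.toSpanSingletonCLE (𝕜 := ℝ) (E := ℂ)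
        (poissonBracket (toComplex H) (W v.1) v.2)) (z, ξ) :=
    (ContinuousLinearMap.toSpanSingletonCLE (𝕜 := ℝ) (E := ℂ)).continuous.continuousAt.comp
      (ContinuousAt.comp (f := fun v : ℝ × Phase d => (W v.1, v.2))
        (continuous_poissonBracket hH).continuousAt hpair)
  have hξc : ContinuousAt (fun v : ℝ × Phase d => fderiv ℝ (W v.1) v.2) (z, ξ) :=
    ContinuousAt.comp (f := fun v : ℝ × Phase d => (W v.1, v.2))
      continuous_eval_fderiv.continuousAt hpair
  exact (hasStrictFDerivAt_uncurry_coprod (u := (z, ξ)) (f := fun z ξ => W z ξ)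
    (f₁ := fun s ζ => ContinuousLinearMap.toSpanSingletonCLE (𝕜 := ℝ) (E := ℂ)
        (poissonBracket (toComplex H) (W s) ζ))
    (f₂ := fun s ζ => fderiv ℝ (W s) ζ) hz' hξ' hzc hξc).differentiableAt

end WignerMoyal

/-! ### Assembly of the theorem -/

theorem mainTheorem6 (d : ℕ) :
    -- the paraxial optical Hamiltonian belongs to the class of Hamiltonians considered below
    (∀ n : EuclideanSpace ℝ (Fin d) → ℝ, n.HasTemperateGrowth → (∃ c > 0, ∀ r, c ≤ n r) →
      (WignerMoyal.opticalHamiltonian n).HasTemperateGrowth) ∧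
    ∀ H : WignerMoyal.Phase d → ℝ, H.HasTemperateGrowth →
    -- the right-hand side: the zeroth term of its expansion is the Poisson bracket, every later
    -- term vanishes as the wavelength tends to zero, and so does all of the rest
    (∀ W : 𝓢(WignerMoyal.Phase d, ℂ),
      (∀ lam ξ, WignerMoyal.moyalTerm lam 0 (WignerMoyal.toComplex H) W ξ
        = WignerMoyal.poissonBracket (WignerMoyal.toComplex H) W ξ) ∧
      (∀ n ≥ 1, ∀ ξ, Tendsto
        (fun lam : ℝ => WignerMoyal.moyalTerm lam n (WignerMoyal.toComplex H) W ξ)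
        (𝓝[>] 0) (𝓝 0)) ∧
      (∀ (N : ℕ) (K : Set (WignerMoyal.Phase d)) (lam₀ : ℝ), IsCompact K → 0 < lam₀ →
        ∃ C : ℝ, ∀ lam ∈ Ioc 0 lam₀, ∀ ξ ∈ K,
          ‖WignerMoyal.moyalBracket lam (WignerMoyal.toComplex H) W ξ
            - ∑ n ∈ Finset.range N,
              WignerMoyal.moyalTerm lam n (WignerMoyal.toComplex H) W ξ‖ ≤ C * lam ^ (2 * N)) ∧
      (∀ ξ, Tendsto
        (fun lam : ℝ => WignerMoyal.moyalBracket lam (WignerMoyal.toComplex H) W ξ)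
        (𝓝[>] 0) (𝓝 (WignerMoyal.poissonBracket (WignerMoyal.toComplex H) W ξ)))) ∧
    -- the equation: limits of solutions solve the Liouville equation, hence are transported
    (∀ (a b : ℝ) (Wl : ℝ → ℝ → 𝓢(WignerMoyal.Phase d, ℂ)) (W : ℝ → 𝓢(WignerMoyal.Phase d, ℂ)),
      (∀ᶠ lam in 𝓝[>] (0 : ℝ), WignerMoyal.SolvesWignerMoyal H lam (Ioo a b) (Wl lam)) →
      TendstoLocallyUniformlyOn Wl W (𝓝[>] 0) (Ioo a b) →
      (∀ z ∈ Ioo a b, ∀ ξ, Tendsto (fun lam => deriv (fun s => Wl lam s ξ) z)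
        (𝓝[>] 0) (𝓝 (deriv (fun s => W s ξ) z))) ∧
      WignerMoyal.SolvesLiouville H (Ioo a b) (fun z => W z) ∧
      WignerMoyal.TransportedAlongRays H (Ioo a b) (fun z => W z)) ∧
    -- the Liouville equation is transport along the rays, and their flow is incompressible
    (∀ (a b : ℝ) (W : ℝ → WignerMoyal.Phase d → ℂ),
      (∀ z ∈ Ioo a b, ∀ ξ, DifferentiableAt ℝ (Function.uncurry W) (z, ξ)) →
      (WignerMoyal.SolvesLiouville H (Ioo a b) W ↔
        WignerMoyal.TransportedAlongRays H (Ioo a b) W)) ∧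
    (∀ ξ, WignerMoyal.divergence (WignerMoyal.hamiltonianField H) ξ = 0) := by
  refine ⟨fun n hn ⟨c, hc, h⟩ => WignerMoyal.hasTemperateGrowth_opticalHamiltonian hn hc h,
    fun H hH => ?_⟩
  have hH2 : ContDiff ℝ 2 H := contDiff_infty.1 hH.1 2
  have hHd : Differentiable ℝ H := hH2.differentiable (by norm_num)
  refine ⟨fun W => ⟨fun lam ξ => WignerMoyal.moyalTerm_zero lam _ _ ξ,
    fun n hn ξ => WignerMoyal.tendsto_moyalTerm hn _ _ ξ, fun N K lam₀ hK hlam₀ => ?_,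
    WignerMoyal.tendsto_moyalBracket hH W⟩, fun a b Wl W hWl hlim => ?_,
    fun a b W hW => ⟨fun h => h.transportedAlongRays hHd hW,
      fun h => h.solvesLiouville hH2 isOpen_Ioo hW⟩,
    WignerMoyal.divergence_hamiltonianField hH2⟩
  · obtain ⟨R, hR, hKR⟩ := hK.isBounded.exists_pos_norm_le
    obtain ⟨q, -, hq⟩ := WignerMoyal.norm_moyalBracket_sub_sum_le
      (WignerMoyal.hasTemperateGrowth_toComplex hH) N R lam₀ hR.le hlam₀
    exact ⟨q W, fun lam hlam ξ hξ => hq lam hlam ξ (hKR ξ hξ) W⟩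
  -- Continuity of `W` is inherited from the approximating solutions through the locally uniform
  -- limit.
  · have hW : ContinuousOn W (Ioo a b) :=
      hlim.continuousOn (hWl.mono fun _ h => h.continuousOn).frequently
    have hder : ∀ z ∈ Ioo a b, ∀ ξ, HasDerivAt (fun s => W s ξ)
        (WignerMoyal.poissonBracket (WignerMoyal.toComplex H) (W z) ξ) z := fun z hz ξ =>
      WignerMoyal.hasDerivAt_limit hH isOpen_Ioo hWl hlim hW hz ξ
    have hL : WignerMoyal.SolvesLiouville H (Ioo a b) (fun z => W z) :=
      ⟨fun z hz ξ => (hder z hz ξ).differentiableAt, fun z hz ξ => by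
        rw [(hder z hz ξ).deriv, WignerMoyal.poissonBracket_comm, neg_add_cancel]⟩
    refine ⟨fun z hz ξ => ?_, hL, hL.transportedAlongRays hHd fun z hz ξ =>
      WignerMoyal.differentiableAt_uncurry_of_hasDerivAt hH2 isOpen_Ioo hW hder hz ξ⟩
    rw [(hder z hz ξ).deriv]
    refine (WignerMoyal.tendsto_moyalBracket_prod hH tendsto_id (hlim.tendsto_at hz) ξ).congr' ?_
    filter_upwards [hWl] with lam h using (h.equation z hz ξ).symm
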